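/- There is an absolute constant \(C>0\) such that the following holds for all integers \(d\ge 1\), \(k\ge 0\). Fix, for each \(i\in\{1,\dots,k\}\), one of the two types "Gaussian" or "Rademacher", and call \(x=x_1\otimes\cdots\otimes x_k\in\mathbb R^{d^k}\) a random Kronecker query if \(x_1,\dots,x_k\in\mathbb R^d\) are independent and each \(x_i\) has iid standard normal entries or iid Rademacher (uniform \(\pm1\)) entries, according to the type chosen for \(i\) (for instance all Gaussian, or all Rademacher). Let \(g\in\mathbb R^{d^k}\) be a vector of iid standard normal entries and let \(A=gg^{\mathsf T}\). (i) Let \(x\) be a random Kronecker query independent of \(g\). Then \(x^{\mathsf T}Ax\) is square-integrable, and, with probability at least \(3/4\), \[ \operatorname{Var}\bigl[x^{\mathsf T}Ax \,\big|\, g\bigr]\;\le\; C\,\bigl(2+\tfrac1d\bigr)^k\,(\operatorname{tr}A)^2 . \] (ii) Let \(\varepsilon>0\), let \(\ell\) be any integer with \(\ell\ge C\,(2+\frac1d)^k/\varepsilon^2\), let \(x^{(1)},\dots,x^{(\ell)}\) be iid random Kronecker queries, jointly independent of \(g\), and let \(H_\ell(A)=\frac1\ell\sum_{j=1}^{\ell}{x^{(j)}}^{\mathsf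 T}A\,x^{(j)}\) be the Kronecker-Hutchinson estimator. Then, with probability at least \(2/3\) over \(g\) and the queries, \[ (1-\varepsilon)\operatorname{tr}A\;\le\; H_\ell(A)\;\le\;(1+\varepsilon)\operatorname{tr}A . \] -/

import Mathlib

open MeasureTheory ProbabilityTheory
open scoped ENNReal Matrix

/-- The law of a vector with iid standard normal entries, indexed by a finite type. -/
noncomputable def gaussianVectorLaw (ι : Type) [Fintype ι] : Measure (ι → ℝ) :=
  Measure.pi fun _ => gaussianReal 0 1

/-- The Rademacher law on `ℝ`: the values `1` and `-1`, each with probability `1/2`. -/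
noncomputable def rademacherLaw : Measure ℝ :=
  (2 : ℝ≥0∞)⁻¹ • (Measure.dirac 1 + Measure.dirac (-1))

/-- The two admissible types of random vectors for a factor of a Kronecker query. -/
inductive FactorKind where
  | gaussian
  | rademacher

/-- The law of a single entry of a factor of the given kind. -/
noncomputable def FactorKind.entryLaw : FactorKind → Measure ℝ
  | .gaussian => gaussianReal 0 1
  | .rademacher => rademacherLaw

instance : IsProbabilityMeasure rademacherLaw := by
  constructor
  rw [rademacherLaw, Measure.smul_apply, Measure.add_apply, measure_univ, measure_univ,
    one_add_one_eq_two, smul_eq_mul]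
  exact ENNReal.inv_mul_cancel (by norm_num) (by norm_num)

instance (κ : FactorKind) : IsProbabilityMeasure κ.entryLaw := by
  cases κ <;> (simp only [FactorKind.entryLaw]; infer_instance)

/-- The joint law of the factors `(x₁, …, x_k)` of a query, `xᵢ ∈ ℝ^d`: the factors are
independent, and `xᵢ` has iid standard normal or iid Rademacher entries, according to `κ i`. -/
noncomputable def factorsLaw (d : ℕ) {k : ℕ} (κ : Fin k → FactorKind) :
    Measure (Fin k → Fin d → ℝ) :=
  Measure.pi fun i => Measure.pi fun _ : Fin d => (κ i).entryLaw

/-- The Kronecker product `x₁ ⊗ ⋯ ⊗ x_k` of `k` vectors of `ℝ^d`. Its `d ^ k` coordinates are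
indexed by the multi-indices `(a₁, …, a_k)` with `aᵢ ∈ {1, …, d}` (Mathlib's convention for
Kronecker products), and the coordinate at `(a₁, …, a_k)` is `∏ i, (xᵢ)_{aᵢ}`. -/
def kroneckerVec {d k : ℕ} (x : Fin k → Fin d → ℝ) : (Fin k → Fin d) → ℝ :=
  fun a => ∏ i, x i (a i)

/-- The quadratic form `vᵀ A v`. -/
def quadForm {ι : Type} [Fintype ι] (A : Matrix ι ι ℝ) (v : ι → ℝ) : ℝ :=
  v ⬝ᵥ (A *ᵥ v)

/-- The Kronecker-Hutchinson estimator `H_ℓ(A) = (1/ℓ) ∑ⱼ x⁽ʲ⁾ᵀ A x⁽ʲ⁾`, where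
`x⁽ʲ⁾ = x⁽ʲ⁾₁ ⊗ ⋯ ⊗ x⁽ʲ⁾_k`. -/
noncomputable def kroneckerHutchinson {d k ℓ : ℕ}
    (A : Matrix (Fin k → Fin d) (Fin k → Fin d) ℝ) (x : Fin ℓ → Fin k → Fin d → ℝ) : ℝ :=
  (1 / (ℓ : ℝ)) * ∑ j, quadForm A (kroneckerVec (x j))

/-- The rank-one matrix `g gᵀ`. -/
def rankOne {ι : Type} (g : ι → ℝ) : Matrix ι ι ℝ :=
  Matrix.vecMulVec g g

/-!
For `A = g gᵀ` one has `xᵀ A x = (x ⬝ g)²` and `tr A = |g|²`. The key is to average the fourth power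
of `x ⬝ g` over `g` as well as over `x`, and over `g` first: given `x`, the variable `x ⬝ g` is
centred Gaussian with variance `|x|²`, so
`E (x ⬝ g)⁴ = 3 E |x|⁴ = 3 ∏ i, E |xᵢ|⁴ ≤ 3 (d² + 2d)^k`
(`integral_pow_four_sum_kroneckerVec_mul_le`). With `N = d^k` this is `3 N² (1 + 2/d)^k`, which is at
most `3 N² (2 + 1/d)^k` because `1/d ≤ 1`.

On the other side, `tr A = |g|²` is at least `N / 512` with probability at least `7/8`
(`gaussianVectorLaw_sum_sq_lt_le`), so up to a constant `N²` can be replaced by `(tr A)²`.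

The conditional variance is at most the conditional second moment of `(x ⬝ g)²`, whose mean is the
fourth moment above, and Markov's inequality gives the variance bound. For the estimator, isotropy
of the queries makes it unbiased given `g`, so its mean squared deviation from `tr A` is at most
`3 N² (2 + 1/d)^k / ℓ` (`integral_kroneckerHutchinson_sub_trace_sq_le_of_hasLaw`), and Chebyshev's
inequality on the joint probability space concludes. The constant is `C = 3 · 8 · 512²`: a factor `8`
for a failure probability `1/8` in Markov's inequality, and `512²` from the small-ball estimate.
-/

/-! ### Moments of the entries -/

/-- The fourth derivative at `0` of the moment generating function `exp (v t² / 2)`. -/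
theorem integral_pow_four_gaussianReal (v : NNReal) :
    ∫ y, y ^ 4 ∂gaussianReal 0 v = 3 * (v : ℝ) ^ 2 := by
  have h := iteratedDeriv_mgf_zero (X := id) (μ := gaussianReal 0 v)
    (by simp [integrableExpSet_id_gaussianReal]) 4
  -- Differentiating `p t * exp (v t² / 2)` replaces the polynomial `p` by `p' + v t p`.
  have step : ∀ (p p' : ℝ → ℝ), (∀ t, HasDerivAt p (p' t) t) →
      deriv (fun t => p t * Real.exp (v * t ^ 2 / 2)) =
        fun t => (p' t + v * t * p t) * Real.exp (v * t ^ 2 / 2) := by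
    intro p p' hp
    funext t
    have he : HasDerivAt (fun t : ℝ => Real.exp (v * t ^ 2 / 2))
        (Real.exp (v * t ^ 2 / 2) * (v * t)) t := by
      have h2 : HasDerivAt (fun t : ℝ => (v : ℝ) * t ^ 2 / 2) (v * t) t := by
        convert! (((hasDerivAt_pow 2 t).const_mul (v : ℝ)).div_const 2) using 1
        push_cast
        ring
      exact h2.exp
    refine ((hp t).mul he).deriv.trans ?_
    ring
  have hm : mgf id (gaussianReal 0 v) = fun t => 1 * Real.exp (v * t ^ 2 / 2) := by
    rw [mgf_id_gaussianReal]
    simp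
  have hlin : ∀ t : ℝ, HasDerivAt (fun t : ℝ => (v : ℝ) * t) v t := fun t => by
    simpa using (hasDerivAt_id t).const_mul (v : ℝ)
  have hsq : ∀ t : ℝ, HasDerivAt (fun t : ℝ => (v : ℝ) + v * t * (v * t)) (2 * v ^ 2 * t) t :=
    fun t => by
      convert! (((hlin t).mul (hlin t)).const_add (v : ℝ)) using 1
      ring
  have hcub : ∀ t : ℝ, HasDerivAt
      (fun t : ℝ => 2 * (v : ℝ) ^ 2 * t + v * t * (v + v * t * (v * t)))
      (2 * (v : ℝ) ^ 2 + (v * (v + v * t * (v * t)) + v * t * (2 * v ^ 2 * t))) t := fun t => by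
    have h1 : HasDerivAt (fun t : ℝ => 2 * (v : ℝ) ^ 2 * t) (2 * (v : ℝ) ^ 2) t := by
      simpa using (hasDerivAt_id t).const_mul (2 * (v : ℝ) ^ 2)
    exact h1.add ((hlin t).mul (hsq t))
  rw [hm, iteratedDeriv_succ', step (fun _ => 1) (fun _ => 0) (fun t => hasDerivAt_const t 1),
    show (fun t : ℝ => (0 + (v : ℝ) * t * 1) * Real.exp (v * t ^ 2 / 2)) =
      fun t : ℝ => (v : ℝ) * t * Real.exp (v * t ^ 2 / 2) by funext t; ring,
    iteratedDeriv_succ', step _ _ hlin, iteratedDeriv_succ', step _ _ hsq,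
    iteratedDeriv_succ', step _ _ hcub, iteratedDeriv_zero] at h
  simp only [Pi.pow_apply, id] at h
  rw [← h]
  simp
  ring

theorem integral_rademacherLaw (f : ℝ → ℝ) : ∫ y, f y ∂rademacherLaw = (f 1 + f (-1)) / 2 := by
  rw [rademacherLaw, integral_smul_measure, integral_add_measure (integrable_dirac (by simp))
    (integrable_dirac (by simp)), integral_dirac, integral_dirac]
  simp
  ring

theorem integrable_pow_entryLaw (κ : FactorKind) (n : ℕ) :
    Integrable (fun y : ℝ => y ^ n) κ.entryLaw := by
  cases κ with
  | gaussian =>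
    exact integrable_pow_of_mem_interior_integrableExpSet (X := id) (μ := gaussianReal 0 1)
      (by simp [integrableExpSet_id_gaussianReal]) n
  | rademacher =>
    exact ((integrable_dirac (by simp)).add_measure (integrable_dirac (by simp))).smul_measure
      (by simp)

theorem memLp_sq_entryLaw (κ : FactorKind) : MemLp (fun y : ℝ => y ^ 2) 2 κ.entryLaw := by
  rw [memLp_two_iff_integrable_sq (by fun_prop)]
  simpa only [← pow_mul] using integrable_pow_entryLaw κ (2 * 2)

theorem integral_entryLaw (κ : FactorKind) : ∫ y, y ∂κ.entryLaw = 0 := by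
  cases κ with
  | gaussian => exact integral_id_gaussianReal
  | rademacher => simp [FactorKind.entryLaw, integral_rademacherLaw]

theorem integral_sq_entryLaw (κ : FactorKind) : ∫ y, y ^ 2 ∂κ.entryLaw = 1 := by
  cases κ with
  | gaussian =>
    have h := variance_fun_id_gaussianReal (μ := 0) (v := 1)
    rw [variance_of_integral_eq_zero (by fun_prop) integral_id_gaussianReal] at h
    simpa [FactorKind.entryLaw] using h
  | rademacher => simp [FactorKind.entryLaw, integral_rademacherLaw]

theorem integral_pow_four_entryLaw_le (κ : FactorKind) : ∫ y, y ^ 4 ∂κ.entryLaw ≤ 3 := by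
  cases κ with
  | gaussian => simp [FactorKind.entryLaw, integral_pow_four_gaussianReal]
  | rademacher =>
    simp only [FactorKind.entryLaw, integral_rademacherLaw]
    norm_num

/-! ### Moments of one factor -/

theorem memLp_sum_sq {ι : Type} [Fintype ι] (κ : FactorKind) :
    MemLp (fun y : ι → ℝ => ∑ j, y j ^ 2) 2 (Measure.pi fun _ : ι => κ.entryLaw) :=
  memLp_finsetSum _ fun j _ =>
    (memLp_sq_entryLaw κ).comp_measurePreserving (measurePreserving_eval _ j)

theorem integral_sum_sq {ι : Type} [Fintype ι] (κ : FactorKind) :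
    ∫ y : ι → ℝ, ∑ j, y j ^ 2 ∂(Measure.pi fun _ : ι => κ.entryLaw) = Fintype.card ι := by
  have hint (j : ι) : Integrable (fun y : ι → ℝ => y j ^ 2)
      (Measure.pi fun _ : ι => κ.entryLaw) :=
    ((memLp_sq_entryLaw κ).comp_measurePreserving (measurePreserving_eval _ j)).integrable
      one_le_two
  rw [integral_finsetSum _ fun j _ => hint j]
  have h (j : ι) : ∫ y : ι → ℝ, y j ^ 2 ∂(Measure.pi fun _ : ι => κ.entryLaw) = 1 := by
    rw [integral_comp_eval (μ := fun _ : ι => κ.entryLaw) (i := j) (f := fun t : ℝ => t ^ 2)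
      (by fun_prop), integral_sq_entryLaw]
  simp [h]

/-- The squared norm of a factor has mean `d` and variance at most `2 d`. -/
theorem integral_sum_sq_sq_le (d : ℕ) (κ : FactorKind) :
    ∫ y : Fin d → ℝ, (∑ j, y j ^ 2) ^ 2 ∂(Measure.pi fun _ : Fin d => κ.entryLaw) ≤
      (d : ℝ) ^ 2 + 2 * d := by
  have hvar := variance_sum_pi (μ := fun _ : Fin d => κ.entryLaw) (X := fun _ t => t ^ 2)
    (fun _ => memLp_sq_entryLaw κ)
  have hone : Var[fun t : ℝ => t ^ 2; κ.entryLaw] ≤ 2 := by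
    rw [variance_eq_sub (memLp_sq_entryLaw κ), integral_sq_entryLaw]
    have h := integral_pow_four_entryLaw_le κ
    simp only [Pi.pow_apply, ← pow_mul]
    norm_num
    linarith
  have hfun : (∑ i : Fin d, fun y : Fin d → ℝ => y i ^ 2) = fun y => ∑ j, y j ^ 2 := by
    ext y
    simp
  rw [hfun, variance_eq_sub (memLp_sum_sq κ), integral_sum_sq] at hvar
  simp only [Pi.pow_apply, Finset.sum_const, Finset.card_univ, Fintype.card_fin,
    nsmul_eq_mul] at hvar
  nlinarith [mul_le_mul_of_nonneg_left hone (Nat.cast_nonneg (α := ℝ) d)]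

theorem integrable_eval_mul_eval {d : ℕ} (κ : FactorKind) (a b : Fin d) :
    Integrable (fun y : Fin d → ℝ => y a * y b) (Measure.pi fun _ : Fin d => κ.entryLaw) := by
  have h (j : Fin d) : MemLp (fun y : Fin d → ℝ => y j) 2
      (Measure.pi fun _ : Fin d => κ.entryLaw) := by
    refine MemLp.comp_measurePreserving (g := fun t : ℝ => t) ?_
      (measurePreserving_eval (fun _ : Fin d => κ.entryLaw) j)
    exact (memLp_two_iff_integrable_sq (by fun_prop)).2 (integrable_pow_entryLaw κ 2)
  exact (h a).integrable_mul (h b)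

/-- A factor is isotropic: its second moment matrix is the identity. -/
theorem integral_eval_mul_eval {d : ℕ} (κ : FactorKind) (a b : Fin d) :
    ∫ y : Fin d → ℝ, y a * y b ∂(Measure.pi fun _ : Fin d => κ.entryLaw) =
      if a = b then 1 else 0 := by
  have hi := iIndepFun_pi (μ := fun _ : Fin d => κ.entryLaw) (X := fun _ t => t)
    (fun _ => by fun_prop)
  have he (n : ℕ) (j : Fin d) : ∫ y : Fin d → ℝ, y j ^ n ∂(Measure.pi fun _ => κ.entryLaw) =
      ∫ t, t ^ n ∂κ.entryLaw :=
    integral_comp_eval (μ := fun _ : Fin d => κ.entryLaw) (i := j) (f := fun t : ℝ => t ^ n)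
      (by fun_prop)
  split_ifs with h
  · subst h
    simp_rw [← pow_two]
    rw [he, integral_sq_entryLaw]
  · rw [(hi.indepFun h).integral_fun_mul_eq_mul_integral
      (measurable_pi_apply a).aestronglyMeasurable (measurable_pi_apply b).aestronglyMeasurable]
    have := he 1 a
    simp only [pow_one] at this
    rw [this, integral_entryLaw, zero_mul]

/-! ### Moments of a Kronecker query -/

instance (d : ℕ) {k : ℕ} (κ : Fin k → FactorKind) : IsProbabilityMeasure (factorsLaw d κ) := by
  unfold factorsLaw
  infer_instance

theorem quadForm_rankOne {ι : Type} [Fintype ι] (g v : ι → ℝ) :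
    quadForm (rankOne g) v = (∑ a, v a * g a) ^ 2 := by
  rw [quadForm, rankOne, Matrix.vecMulVec_mulVec, dotProduct_smul, dotProduct_comm g v]
  simp [dotProduct, pow_two]

theorem trace_rankOne {ι : Type} [Fintype ι] (g : ι → ℝ) :
    (rankOne g).trace = ∑ a, g a ^ 2 := by
  simp [rankOne, Matrix.trace_vecMulVec, dotProduct, pow_two]

theorem measurable_kroneckerVec {d k : ℕ} :
    Measurable (kroneckerVec : (Fin k → Fin d → ℝ) → (Fin k → Fin d) → ℝ) := by
  unfold kroneckerVec
  fun_prop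

theorem sum_sq_kroneckerVec {d k : ℕ} (x : Fin k → Fin d → ℝ) :
    ∑ a, kroneckerVec x a ^ 2 = ∏ i, ∑ j, x i j ^ 2 := by
  rw [Finset.prod_univ_sum, Fintype.piFinset_univ]
  simp [kroneckerVec, Finset.prod_pow]

theorem memLp_sum_sq_kroneckerVec (d : ℕ) {k : ℕ} (κ : Fin k → FactorKind) :
    MemLp (fun x => ∑ a, kroneckerVec x a ^ 2) 2 (factorsLaw d κ) := by
  simp_rw [sum_sq_kroneckerVec]
  rw [memLp_two_iff_integrable_sq (Measurable.aestronglyMeasurable (by fun_prop))]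
  simp_rw [← Finset.prod_pow]
  exact Integrable.fintype_prod_dep (f := fun _ (y : Fin d → ℝ) => (∑ j, y j ^ 2) ^ 2)
    fun i => (memLp_sum_sq (κ i)).integrable_sq

theorem integral_sum_sq_kroneckerVec_sq_le (d : ℕ) {k : ℕ} (κ : Fin k → FactorKind) :
    ∫ x, (∑ a, kroneckerVec x a ^ 2) ^ 2 ∂factorsLaw d κ ≤ ((d : ℝ) ^ 2 + 2 * d) ^ k := by
  simp_rw [sum_sq_kroneckerVec, ← Finset.prod_pow]
  unfold factorsLaw
  rw [integral_fintype_prod_eq_prod fun _ (y : Fin d → ℝ) => (∑ j, y j ^ 2) ^ 2]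
  refine (Finset.prod_le_prod (fun i _ => integral_nonneg fun y => sq_nonneg _)
    fun i _ => integral_sum_sq_sq_le d (κ i)).trans_eq ?_
  simp

/-- The Cauchy-Schwarz domination behind all integrability statements. -/
theorem norm_sq_sum_mul_le {ι : Type} [Fintype ι] (v g : ι → ℝ) :
    ‖(∑ a, v a * g a) ^ 2‖ ≤ ‖(∑ a, v a ^ 2) * ∑ a, g a ^ 2‖ := by
  have h : 0 ≤ (∑ a, v a ^ 2) * ∑ a, g a ^ 2 := by positivity
  rw [Real.norm_of_nonneg (sq_nonneg _), Real.norm_of_nonneg h]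
  exact Finset.sum_mul_sq_le_sq_mul_sq _ _ _

theorem memLp_sq_sum_kroneckerVec_mul {d k : ℕ} (κ : Fin k → FactorKind)
    (g : (Fin k → Fin d) → ℝ) :
    MemLp (fun x => (∑ a, kroneckerVec x a * g a) ^ 2) 2 (factorsLaw d κ) :=
  ((memLp_sum_sq_kroneckerVec d κ).mul_const (∑ a, g a ^ 2)).mono
    (by have := measurable_kroneckerVec (d := d) (k := k); fun_prop)
    (.of_forall fun _ => norm_sq_sum_mul_le _ _)

/-- Kronecker queries are isotropic, so that the quadratic form is an unbiased estimator of the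
trace. -/
theorem integral_sq_sum_kroneckerVec_mul {d k : ℕ} (κ : Fin k → FactorKind)
    (g : (Fin k → Fin d) → ℝ) :
    ∫ x, (∑ a, kroneckerVec x a * g a) ^ 2 ∂factorsLaw d κ = ∑ a, g a ^ 2 := by
  have hprod (x : Fin k → Fin d → ℝ) (a b : Fin k → Fin d) :
      kroneckerVec x a * g a * (kroneckerVec x b * g b) =
        g a * g b * ∏ i, x i (a i) * x i (b i) := by
    simp only [kroneckerVec, Finset.prod_mul_distrib]
    ring
  have hint (a b : Fin k → Fin d) :
      Integrable (fun x : Fin k → Fin d → ℝ => g a * g b * ∏ i, x i (a i) * x i (b i))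
        (factorsLaw d κ) :=
    (Integrable.fintype_prod_dep (f := fun i (y : Fin d → ℝ) => y (a i) * y (b i))
      fun i => integrable_eval_mul_eval (κ i) (a i) (b i)).const_mul _
  have hval (a b : Fin k → Fin d) :
      ∫ x : Fin k → Fin d → ℝ, g a * g b * ∏ i, x i (a i) * x i (b i) ∂factorsLaw d κ =
        if a = b then g a * g b else 0 := by
    rw [integral_const_mul, factorsLaw,
      integral_fintype_prod_eq_prod fun i (y : Fin d → ℝ) => y (a i) * y (b i)]
    simp_rw [integral_eval_mul_eval, Finset.prod_ite_zero, funext_iff]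
    simp
  simp_rw [pow_two (Finset.sum _ _), Finset.sum_mul_sum, hprod]
  rw [integral_finsetSum _ fun a _ => integrable_finsetSum _ fun b _ => hint a b]
  refine Finset.sum_congr rfl fun a _ => ?_
  rw [integral_finsetSum _ fun b _ => hint a b]
  simp [hval, pow_two]

/-! ### The Gaussian vector -/

instance (ι : Type) [Fintype ι] : IsProbabilityMeasure (gaussianVectorLaw ι) := by
  unfold gaussianVectorLaw
  infer_instance

theorem memLp_sum_sq_gaussianVectorLaw (ι : Type) [Fintype ι] :
    MemLp (fun g : ι → ℝ => ∑ a, g a ^ 2) 2 (gaussianVectorLaw ι) :=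
  memLp_sum_sq .gaussian

theorem map_sum_mul_gaussianVectorLaw {ι : Type} [Fintype ι] (v : ι → ℝ) :
    (gaussianVectorLaw ι).map (fun g => ∑ a, v a * g a) =
      gaussianReal 0 (∑ a, NNReal.mk (v a ^ 2) (sq_nonneg _)) := by
  have hfun (s : Finset ι) : (∑ a ∈ s, fun g : ι → ℝ => v a * g a) =
      fun g => ∑ a ∈ s, v a * g a := by
    ext g
    simp
  have hind := iIndepFun_pi (μ := fun _ : ι => gaussianReal 0 1) (X := fun a t => v a * t)
    (fun _ => by fun_prop)
  suffices h : ∀ s : Finset ι, (gaussianVectorLaw ι).map (∑ a ∈ s, fun g => v a * g a) =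
      gaussianReal 0 (∑ a ∈ s, NNReal.mk (v a ^ 2) (sq_nonneg _)) by
    rw [← h, hfun]
  intro s
  induction s using Finset.cons_induction with
  | empty =>
    rw [Finset.sum_empty, Finset.sum_empty, gaussianReal_zero_var]
    exact (Measure.map_const _ (0 : ℝ)).trans (by simp)
  | cons a s ha ih =>
    have hone : (gaussianVectorLaw ι).map (fun g => v a * g a) =
        gaussianReal 0 (NNReal.mk (v a ^ 2) (sq_nonneg _)) := by
      have hlaw : HasLaw (fun g : ι → ℝ => g a) (gaussianReal 0 1) (gaussianVectorLaw ι) :=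
        (measurePreserving_eval (fun _ : ι => gaussianReal 0 1) a).hasLaw
      simpa using (gaussianReal_const_mul hlaw (v a)).map_eq
    have hadd := (hind.indepFun_finsetSum_of_notMem (fun _ => by fun_prop) ha).symm
    rw [Finset.sum_cons, Finset.sum_cons]
    have := gaussianReal_add_gaussianReal_of_indepFun hadd hone ih
    rwa [add_zero] at this

theorem integral_pow_four_sum_mul_gaussianVectorLaw {ι : Type} [Fintype ι] (v : ι → ℝ) :
    ∫ g, ((∑ a, v a * g a) ^ 2) ^ 2 ∂gaussianVectorLaw ι = 3 * (∑ a, v a ^ 2) ^ 2 := by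
  have h := integral_pow_four_gaussianReal (∑ a, NNReal.mk (v a ^ 2) (sq_nonneg _))
  rw [← map_sum_mul_gaussianVectorLaw, integral_map (Measurable.aemeasurable (by fun_prop))
    (by fun_prop)] at h
  simpa [← pow_mul, NNReal.coe_sum] using h

/-- The standard Gaussian density is at most `1 / 2`, and the interval has length `1 / 8`. -/
theorem gaussianReal_sq_lt_le :
    (gaussianReal 0 1).real {y | y ^ 2 < 1 / 256} ≤ 1 / 16 := by
  have hset : {y : ℝ | y ^ 2 < 1 / 256} = Set.Ioo (-(1 / 16)) (1 / 16) := by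
    ext y
    rw [Set.mem_ofPred_eq, show (1 / 256 : ℝ) = (1 / 16) ^ 2 by norm_num, sq_lt_sq,
      abs_of_pos (by norm_num : (0 : ℝ) < 1 / 16), abs_lt, Set.mem_Ioo]
  have hpdf (y : ℝ) : gaussianPDF 0 1 y ≤ ENNReal.ofReal (1 / 2) := by
    refine ENNReal.ofReal_le_ofReal ?_
    rw [gaussianPDFReal]
    have h1 : (2 : ℝ) ≤ √(2 * Real.pi * (1 : NNReal)) := by
      refine Real.le_sqrt_of_sq_le ?_
      have := Real.two_le_pi
      simp only [NNReal.coe_one]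
      linarith
    have h2 : Real.exp (-(y - 0) ^ 2 / (2 * (1 : NNReal))) ≤ 1 := by
      rw [Real.exp_le_one_iff]
      simp only [NNReal.coe_one]
      nlinarith [sq_nonneg (y - 0)]
    calc _ ≤ (2 : ℝ)⁻¹ * 1 := by gcongr
      _ = 1 / 2 := by norm_num
  refine ENNReal.toReal_le_of_le_ofReal (by norm_num) ?_
  rw [hset, gaussianReal_apply 0 one_ne_zero]
  calc _ ≤ ∫⁻ _ in Set.Ioo (-(1 / 16) : ℝ) (1 / 16), ENNReal.ofReal (1 / 2) :=
        lintegral_mono fun y => hpdf y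
    _ = ENNReal.ofReal (1 / 16) := by
      rw [setLIntegral_const, Real.volume_Ioo, ← ENNReal.ofReal_mul (by norm_num)]
      norm_num

/-- The small-ball estimate: a squared norm below `n / 512` forces half of the `n` coordinates to
have square below `1 / 256`, whereas on average at most `n / 16` of them do. -/
theorem gaussianVectorLaw_sum_sq_lt_le (ι : Type) [Fintype ι] [Nonempty ι] :
    (gaussianVectorLaw ι).real {g | ∑ a, g a ^ 2 < Fintype.card ι / 512} ≤ 1 / 8 := by
  have hS : MeasurableSet {y : ℝ | y ^ 2 < 1 / 256} :=
    measurableSet_lt (by fun_prop) (by fun_prop)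
  set S := {y : ℝ | y ^ 2 < 1 / 256} with hSdef
  have hn : (0 : ℝ) < Fintype.card ι := by exact_mod_cast Fintype.card_pos
  have hmp (a : ι) : MeasurePreserving (Function.eval a) (gaussianVectorLaw ι)
      (gaussianReal 0 1) := measurePreserving_eval (fun _ : ι => gaussianReal 0 1) a
  have hint (a : ι) : Integrable (fun g : ι → ℝ => S.indicator (fun _ => (1 : ℝ)) (g a))
      (gaussianVectorLaw ι) :=
    (hmp a).integrable_comp_of_integrable ((integrable_const 1).indicator hS)
  have hval (a : ι) : ∫ g : ι → ℝ, S.indicator (fun _ => (1 : ℝ)) (g a) ∂gaussianVectorLaw ι ≤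
      1 / 16 := by
    have h := integral_comp_eval (μ := fun _ : ι => gaussianReal 0 1) (i := a)
      (f := S.indicator fun _ => (1 : ℝ))
      (measurable_const.indicator hS).aestronglyMeasurable
    rw [gaussianVectorLaw, h, integral_indicator hS]
    rw [setIntegral_const, smul_eq_mul, mul_one]
    exact gaussianReal_sq_lt_le
  have hmarkov := mul_meas_ge_le_integral_of_nonneg (μ := gaussianVectorLaw ι)
    (f := fun g => ∑ a, S.indicator (fun _ => (1 : ℝ)) (g a))
    (.of_forall fun g => Finset.sum_nonneg fun a _ => Set.indicator_nonneg (by simp) _)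
    (integrable_finsetSum _ fun a _ => hint a) (Fintype.card ι / 2)
  rw [integral_finsetSum _ fun a _ => hint a] at hmarkov
  have hsum : ∑ a : ι, ∫ g : ι → ℝ, S.indicator (fun _ => (1 : ℝ)) (g a) ∂gaussianVectorLaw ι ≤
      Fintype.card ι * (1 / 16) := by
    simpa using Finset.sum_le_sum fun a (_ : a ∈ Finset.univ) => hval a
  have hsub : {g : ι → ℝ | ∑ a, g a ^ 2 < Fintype.card ι / 512} ⊆
      {g | (Fintype.card ι : ℝ) / 2 ≤ ∑ a, S.indicator (fun _ => (1 : ℝ)) (g a)} := by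
    intro g hg
    -- Summed over `a`, this bounds the number of small coordinates below by `n - 256 |g|²`.
    have hpt (a : ι) : 1 - 256 * g a ^ 2 ≤ S.indicator (fun _ => (1 : ℝ)) (g a) := by
      by_cases h : g a ∈ S
      · rw [Set.indicator_of_mem h]
        nlinarith [sq_nonneg (g a)]
      · rw [Set.indicator_of_notMem h]
        simp only [hSdef, Set.mem_ofPred_eq, not_lt] at h
        linarith
    have := Finset.sum_le_sum fun a (_ : a ∈ Finset.univ) => hpt a
    rw [Finset.sum_sub_distrib, ← Finset.mul_sum] at this
    simp only [Finset.sum_const, Finset.card_univ, nsmul_eq_mul, mul_one] at this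
    simp only [Set.mem_ofPred_eq] at hg ⊢
    linarith
  have hmono := measureReal_mono (μ := gaussianVectorLaw ι) hsub
  nlinarith

/-! ### Joint moments of the Gaussian vector and the queries -/

/-- A failure probability bounds the success probability without measurability of the events. -/
theorem one_sub_le_measureReal_of_imp {Ω : Type*} [MeasurableSpace Ω] {P : Measure Ω}
    [IsProbabilityMeasure P] {s t u : Set Ω} {p q : ℝ} (ht : P.real t ≤ p) (hu : P.real u ≤ q)
    (h : ∀ᵐ ω ∂P, ω ∉ t → ω ∉ u → ω ∈ s) : 1 - p - q ≤ P.real s := by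
  have hle : P (Set.univ) ≤ P (s ∪ (t ∪ u)) := by
    refine measure_mono_ae ?_
    filter_upwards [h] with ω hω _
    change ω ∈ s ∪ (t ∪ u)
    by_cases h1 : ω ∈ t
    · exact .inr (.inl h1)
    by_cases h2 : ω ∈ u
    · exact .inr (.inr h2)
    · exact .inl (hω h1 h2)
  have h1 : 1 ≤ P.real (s ∪ (t ∪ u)) := by
    simpa [measureReal_def] using ENNReal.toReal_mono (measure_ne_top P _) hle
  have h2 := measureReal_union_le (μ := P) s (t ∪ u)
  have h3 := measureReal_union_le (μ := P) t u
  linarith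

/-- Uses `1 + 2 / d ≤ 2 + 1 / d`, which is `1 / d ≤ 1`. -/
theorem factor_moment_le {d k : ℕ} (hd : 1 ≤ d) :
    ((d : ℝ) ^ 2 + 2 * d) ^ k ≤ (2 + 1 / (d : ℝ)) ^ k * ((d : ℝ) ^ k) ^ 2 := by
  have hd' : (1 : ℝ) ≤ d := by exact_mod_cast hd
  rw [← pow_mul, mul_comm k 2, pow_mul, ← mul_pow]
  have : (2 + 1 / (d : ℝ)) * (d : ℝ) ^ 2 = 2 * (d : ℝ) ^ 2 + d := by field_simp
  gcongr
  rw [this]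
  nlinarith

/-- With probability at least `7/8`, the trace of `g gᵀ` is at least `d^k / 512`. -/
theorem measureReal_trace_rankOne_lt_le {d k : ℕ} (hd : 1 ≤ d) {Ω : Type*}
    [MeasurableSpace Ω] {P : Measure Ω} {g : Ω → (Fin k → Fin d) → ℝ}
    (hg : HasLaw g (gaussianVectorLaw (Fin k → Fin d)) P) :
    P.real {ω | (rankOne (g ω)).trace < (d : ℝ) ^ k / 512} ≤ 1 / 8 := by
  have : NeZero d := ⟨by omega⟩
  have h := gaussianVectorLaw_sum_sq_lt_le (Fin k → Fin d)
  simp_rw [trace_rankOne]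
  rw [← hg.measureReal_eq (measurableSet_lt (by fun_prop) (by fun_prop))] at h
  simpa using h

section Joint

variable {d k : ℕ} {κ : Fin k → FactorKind} {Ω : Type*} [MeasurableSpace Ω] {P : Measure Ω}
  [IsProbabilityMeasure P] {g : Ω → (Fin k → Fin d) → ℝ}

theorem integrable_pow_four_sum_kroneckerVec_mul_prod (κ : Fin k → FactorKind) :
    Integrable (fun z : ((Fin k → Fin d) → ℝ) × (Fin k → Fin d → ℝ) =>
        ((∑ a, kroneckerVec z.2 a * z.1 a) ^ 2) ^ 2)
      ((gaussianVectorLaw (Fin k → Fin d)).prod (factorsLaw d κ)) := by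
  refine ((memLp_sum_sq_gaussianVectorLaw (Fin k → Fin d)).integrable_sq.mul_prod
    (memLp_sum_sq_kroneckerVec d κ).integrable_sq).mono
    (Measurable.aestronglyMeasurable ?_) (.of_forall fun z => ?_)
  · have := measurable_kroneckerVec (d := d) (k := k)
    fun_prop
  · rw [← mul_pow, norm_pow, norm_pow ((∑ a, z.1 a ^ 2) * _), mul_comm (∑ a, z.1 a ^ 2)]
    gcongr
    exact norm_sq_sum_mul_le _ _

/-- Integrating over the Gaussian vector first, the fourth moment of `x ⬝ g` is
`3 E |x|⁴ ≤ 3 (d² + 2d)^k`. -/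
theorem integral_pow_four_sum_kroneckerVec_mul_le (κ : Fin k → FactorKind) :
    ∫ g, ∫ x, ((∑ a, kroneckerVec x a * g a) ^ 2) ^ 2 ∂factorsLaw d κ
        ∂gaussianVectorLaw (Fin k → Fin d) ≤ 3 * ((d : ℝ) ^ 2 + 2 * d) ^ k := by
  rw [integral_integral_swap (integrable_pow_four_sum_kroneckerVec_mul_prod κ)]
  simp_rw [integral_pow_four_sum_mul_gaussianVectorLaw, integral_const_mul]
  exact mul_le_mul_of_nonneg_left (integral_sum_sq_kroneckerVec_sq_le d κ) (by norm_num)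

theorem memLp_quadForm_rankOne_kroneckerVec {x : Ω → Fin k → Fin d → ℝ}
    (hgm : Measurable g) (hg : HasLaw g (gaussianVectorLaw (Fin k → Fin d)) P)
    (hxm : Measurable x) (hx : HasLaw x (factorsLaw d κ) P) (hgx : IndepFun g x P) :
    MemLp (fun ω => quadForm (rankOne (g ω)) (kroneckerVec (x ω))) 2 P := by
  have hlaw := hgx.hasLaw_prod hg hx
  have hk := measurable_kroneckerVec (d := d) (k := k)
  simp_rw [quadForm_rankOne]
  rw [memLp_two_iff_integrable_sq (Measurable.aestronglyMeasurable (by fun_prop))]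
  exact (hlaw.measurePreserving (hgm.prodMk hxm)).integrable_comp_of_integrable
    (integrable_pow_four_sum_kroneckerVec_mul_prod κ)

theorem integral_quadForm_rankOne_kroneckerVec_sq_le {x : Ω → Fin k → Fin d → ℝ}
    (hg : HasLaw g (gaussianVectorLaw (Fin k → Fin d)) P)
    (hx : HasLaw x (factorsLaw d κ) P) (hgx : IndepFun g x P) :
    ∫ ω, quadForm (rankOne (g ω)) (kroneckerVec (x ω)) ^ 2 ∂P ≤
      3 * ((d : ℝ) ^ 2 + 2 * d) ^ k := by
  have hint := integrable_pow_four_sum_kroneckerVec_mul_prod (d := d) κ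
  simp_rw [quadForm_rankOne]
  refine le_trans (le_of_eq ?_) (integral_pow_four_sum_kroneckerVec_mul_le (d := d) κ)
  rw [← integral_prod _ hint]
  exact (hgx.hasLaw_prod hg hx).integral_comp hint.aestronglyMeasurable

/-- For a fixed vector `g`, the estimator is unbiased and its variance is at most `1/ℓ` times the
second moment of a single quadratic form. -/
theorem integral_kroneckerHutchinson_sub_trace_sq_le {ℓ : ℕ} (hℓ : 0 < ℓ)
    (κ : Fin k → FactorKind) (v : (Fin k → Fin d) → ℝ) :
    ∫ x, (kroneckerHutchinson (rankOne v) x - (rankOne v).trace) ^ 2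
        ∂(Measure.pi fun _ : Fin ℓ => factorsLaw d κ) ≤
      (1 / ℓ) * ∫ x, ((∑ a, kroneckerVec x a * v a) ^ 2) ^ 2 ∂factorsLaw d κ := by
  have hℓ' : (0 : ℝ) < ℓ := by exact_mod_cast hℓ
  have hq := memLp_sq_sum_kroneckerVec_mul κ v
  set q : (Fin k → Fin d → ℝ) → ℝ := fun x => (∑ a, kroneckerVec x a * v a) ^ 2 with hqdef
  set μ := Measure.pi fun _ : Fin ℓ => factorsLaw d κ
  have hmean : ∫ x, q x ∂factorsLaw d κ = (rankOne v).trace := by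
    rw [trace_rankOne, ← integral_sq_sum_kroneckerVec_mul κ v]
  have hcomp (j : Fin ℓ) : MemLp (fun x : Fin ℓ → Fin k → Fin d → ℝ => q (x j)) 2 μ :=
    hq.comp_measurePreserving (measurePreserving_eval (fun _ : Fin ℓ => factorsLaw d κ) j)
  have hH : (fun x => kroneckerHutchinson (rankOne v) x) =
      (1 / (ℓ : ℝ)) • ∑ j : Fin ℓ, fun x : Fin ℓ → Fin k → Fin d → ℝ => q (x j) := by
    ext x
    simp [kroneckerHutchinson, quadForm_rankOne, hqdef]
  have hHmem : MemLp (fun x => kroneckerHutchinson (rankOne v) x) 2 μ := by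
    rw [hH]
    exact (memLp_finsetSum' _ fun j _ => hcomp j).const_smul _
  have hHmean : ∫ x, kroneckerHutchinson (rankOne v) x ∂μ = (rankOne v).trace := by
    have hev (j : Fin ℓ) : ∫ x : Fin ℓ → Fin k → Fin d → ℝ, q (x j) ∂μ = (rankOne v).trace := by
      rw [← hmean]
      exact integral_comp_eval (μ := fun _ : Fin ℓ => factorsLaw d κ) (i := j) (f := q) hq.1
    simp only [hH, Pi.smul_apply, Finset.sum_apply, smul_eq_mul]
    rw [integral_const_mul, integral_finsetSum _ fun j _ => (hcomp j).integrable one_le_two]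
    simp only [hev, Finset.sum_const, Finset.card_univ, Fintype.card_fin, nsmul_eq_mul]
    field_simp
  have hvar := variance_sum_pi (μ := fun _ : Fin ℓ => factorsLaw d κ) (X := fun _ => q)
    fun _ => hq
  rw [← hHmean, ← variance_eq_integral hHmem.aemeasurable, hH, variance_smul, hvar]
  have hle : Var[q; factorsLaw d κ] ≤ ∫ x, q x ^ 2 ∂factorsLaw d κ :=
    variance_le_expectation_sq hq.1
  simp only [Finset.sum_const, Finset.card_univ, Fintype.card_fin, nsmul_eq_mul]
  calc (1 / (ℓ : ℝ)) ^ 2 * (ℓ * Var[q; factorsLaw d κ]) =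
        1 / ℓ * Var[q; factorsLaw d κ] := by field_simp
    _ ≤ _ := by gcongr

variable {ℓ : ℕ} {x : Fin ℓ → Ω → Fin k → Fin d → ℝ}

theorem memLp_kroneckerHutchinson_sub_trace (hgm : Measurable g)
    (hg : HasLaw g (gaussianVectorLaw (Fin k → Fin d)) P) (hxm : ∀ j, Measurable (x j))
    (hx : ∀ j, HasLaw (x j) (factorsLaw d κ) P) (hgx : IndepFun g (fun ω j => x j ω) P) :
    MemLp (fun ω => kroneckerHutchinson (rankOne (g ω)) (fun j => x j ω) -
      (rankOne (g ω)).trace) 2 P := by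
  have hq (j : Fin ℓ) :
      MemLp (fun ω => quadForm (rankOne (g ω)) (kroneckerVec (x j ω))) 2 P := by
    have hgj : IndepFun g (x j) P := hgx.comp measurable_id (measurable_pi_apply j)
    exact memLp_quadForm_rankOne_kroneckerVec hgm hg (hxm j) (hx j) hgj
  have htr : MemLp (fun ω => (rankOne (g ω)).trace) 2 P := by
    simp_rw [trace_rankOne]
    exact (memLp_sum_sq_gaussianVectorLaw _).comp_measurePreserving (hg.measurePreserving hgm)
  have hsum : MemLp (fun ω => ∑ j, quadForm (rankOne (g ω)) (kroneckerVec (x j ω))) 2 P :=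
    memLp_finsetSum Finset.univ fun j _ => hq j
  exact (hsum.const_mul (1 / (ℓ : ℝ))).sub htr

theorem integral_kroneckerHutchinson_sub_trace_sq_le_of_hasLaw (hℓ : 0 < ℓ) (hgm : Measurable g)
    (hg : HasLaw g (gaussianVectorLaw (Fin k → Fin d)) P) (hxm : ∀ j, Measurable (x j))
    (hx : ∀ j, HasLaw (x j) (factorsLaw d κ) P) (hxi : iIndepFun x P)
    (hgx : IndepFun g (fun ω j => x j ω) P) :
    ∫ ω, (kroneckerHutchinson (rankOne (g ω)) (fun j => x j ω) - (rankOne (g ω)).trace) ^ 2 ∂P ≤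
      3 * ((d : ℝ) ^ 2 + 2 * d) ^ k / ℓ := by
  have hlaw := hgx.hasLaw_prod hg (hxi.hasLaw_pi hx)
  have hk := measurable_kroneckerVec (d := d) (k := k)
  let F : ((Fin k → Fin d) → ℝ) × (Fin ℓ → Fin k → Fin d → ℝ) → ℝ := fun z =>
    (kroneckerHutchinson (rankOne z.1) z.2 - (rankOne z.1).trace) ^ 2
  have hFm : Measurable F := by
    simp only [F, kroneckerHutchinson, quadForm_rankOne, trace_rankOne]
    fun_prop
  have hF : Integrable F ((gaussianVectorLaw (Fin k → Fin d)).prod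
      (Measure.pi fun _ : Fin ℓ => factorsLaw d κ)) := by
    have hmp := hlaw.measurePreserving (hgm.prodMk (measurable_pi_lambda _ hxm))
    rw [← hmp.integrable_comp hFm.aestronglyMeasurable]
    exact (memLp_kroneckerHutchinson_sub_trace hgm hg hxm hx hgx).integrable_sq
  have h1 : ∫ ω, F (g ω, fun j => x j ω) ∂P = _ := hlaw.integral_comp hFm.aestronglyMeasurable
  have h2 := integral_mono hF.integral_prod_left
    ((integrable_pow_four_sum_kroneckerVec_mul_prod κ).integral_prod_left.const_mul (1 / (ℓ : ℝ)))
    fun v => integral_kroneckerHutchinson_sub_trace_sq_le hℓ κ v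
  rw [integral_const_mul, ← integral_prod _ hF] at h2
  refine (h1.trans_le h2).trans ?_
  have h3 := integral_pow_four_sum_kroneckerVec_mul_le (d := d) κ
  calc _ ≤ 1 / (ℓ : ℝ) * (3 * ((d : ℝ) ^ 2 + 2 * d) ^ k) := by gcongr
    _ = _ := by ring

/-! ### The variance bound and the accuracy of the estimator -/

theorem measureReal_condVar_quadForm_le (hd : 1 ≤ d) {x : Ω → Fin k → Fin d → ℝ}
    (hgm : Measurable g) (hg : HasLaw g (gaussianVectorLaw (Fin k → Fin d)) P)
    (hxm : Measurable x) (hx : HasLaw x (factorsLaw d κ) P) (hgx : IndepFun g x P) :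
    3 / 4 ≤ P.real {ω |
      Var[fun ω' => quadForm (rankOne (g ω')) (kroneckerVec (x ω')); P |
          MeasurableSpace.comap g inferInstance] ω
        ≤ 24 * 512 ^ 2 * ((2 + 1 / (d : ℝ)) ^ k * (rankOne (g ω)).trace ^ 2)} := by
  have hm : MeasurableSpace.comap g inferInstance ≤ ‹MeasurableSpace Ω› := hgm.comap_le
  have hd' : (0 : ℝ) < d := by exact_mod_cast hd
  have hmem := memLp_quadForm_rankOne_kroneckerVec hgm hg hxm hx hgx
  set q : Ω → ℝ := fun ω => quadForm (rankOne (g ω)) (kroneckerVec (x ω)) with hq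
  -- An upper bound for the mean of the conditional second moment.
  set M : ℝ := 3 * ((2 + 1 / (d : ℝ)) ^ k * ((d : ℝ) ^ k) ^ 2) with hM
  have hMpos : 0 < M := by positivity
  have hmarkov := mul_meas_ge_le_integral_of_nonneg (μ := P)
    (f := P[q ^ 2 | MeasurableSpace.comap g inferInstance])
    (condExp_nonneg (.of_forall fun ω => sq_nonneg (q ω))) integrable_condExp (8 * M)
  rw [integral_condExp hm] at hmarkov
  have hsecond : ∫ ω, (q ^ 2) ω ∂P ≤ M :=
    (integral_quadForm_rankOne_kroneckerVec_sq_le hg hx hgx).trans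
      (mul_le_mul_of_nonneg_left (factor_moment_le hd) (by norm_num))
  have hbad : P.real {ω | 8 * M ≤ (P[q ^ 2 | MeasurableSpace.comap g inferInstance]) ω} ≤ 1 / 8 := by
    refine le_of_mul_le_mul_left ?_ (by positivity : (0 : ℝ) < 8 * M)
    linarith
  refine le_trans (by norm_num) (one_sub_le_measureReal_of_imp
    (measureReal_trace_rankOne_lt_le hd hg) hbad ?_)
  filter_upwards [condVar_ae_le_condExp_sq hm hmem] with ω hω htr hce
  simp only [not_lt, not_le] at htr hce ⊢
  calc _ ≤ 8 * M := hω.trans hce.le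
    _ = 24 * 512 ^ 2 * ((2 + 1 / (d : ℝ)) ^ k * ((d : ℝ) ^ k / 512) ^ 2) := by rw [hM]; ring
    _ ≤ _ := by gcongr

theorem measureReal_kroneckerHutchinson_sub_trace_le (hd : 1 ≤ d) (hgm : Measurable g)
    (hg : HasLaw g (gaussianVectorLaw (Fin k → Fin d)) P) {ε : ℝ} (hε : 0 < ε)
    (hℓ : 24 * 512 ^ 2 * ((2 + 1 / (d : ℝ)) ^ k / ε ^ 2) ≤ (ℓ : ℝ))
    (hxm : ∀ j, Measurable (x j)) (hx : ∀ j, HasLaw (x j) (factorsLaw d κ) P)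
    (hxi : iIndepFun x P) (hgx : IndepFun g (fun ω j => x j ω) P) :
    2 / 3 ≤ P.real {ω |
      |kroneckerHutchinson (rankOne (g ω)) (fun j => x j ω) - (rankOne (g ω)).trace|
        ≤ ε * (rankOne (g ω)).trace} := by
  have hd' : (0 : ℝ) < d := by exact_mod_cast hd
  have hℓ' : (0 : ℝ) < ℓ := lt_of_lt_of_le (by positivity) hℓ
  set D : Ω → ℝ := fun ω =>
    kroneckerHutchinson (rankOne (g ω)) (fun j => x j ω) - (rankOne (g ω)).trace with hD
  -- On the event that the trace is at least `d^k / 512`, a deviation below `r` is good enough.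
  set r : ℝ := ε * ((d : ℝ) ^ k / 512) with hr
  have hrpos : 0 < r := by positivity
  have hmarkov := mul_meas_ge_le_integral_of_nonneg (μ := P) (f := fun ω => D ω ^ 2)
    (.of_forall fun ω => sq_nonneg _)
    (memLp_kroneckerHutchinson_sub_trace hgm hg hxm hx hgx).integrable_sq (r ^ 2)
  have hsecond : ∫ ω, D ω ^ 2 ∂P ≤ r ^ 2 * (1 / 8) := by
    refine (integral_kroneckerHutchinson_sub_trace_sq_le_of_hasLaw (by exact_mod_cast hℓ')
      hgm hg hxm hx hxi hgx).trans ?_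
    rw [div_le_iff₀ hℓ']
    calc 3 * ((d : ℝ) ^ 2 + 2 * d) ^ k ≤ 3 * ((2 + 1 / (d : ℝ)) ^ k * ((d : ℝ) ^ k) ^ 2) :=
          mul_le_mul_of_nonneg_left (factor_moment_le hd) (by norm_num)
      _ = r ^ 2 * (1 / 8) * (24 * 512 ^ 2 * ((2 + 1 / (d : ℝ)) ^ k / ε ^ 2)) := by
          rw [hr]
          field_simp
          norm_num
      _ ≤ _ := by gcongr
  have hbad : P.real {ω | r ^ 2 ≤ D ω ^ 2} ≤ 1 / 8 :=
    le_of_mul_le_mul_left (hmarkov.trans hsecond) (by positivity)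
  refine le_trans (by norm_num) (one_sub_le_measureReal_of_imp
    (measureReal_trace_rankOne_lt_le hd hg) hbad (.of_forall fun ω htr hdev => ?_))
  simp only [Set.mem_ofPred_eq, not_lt, not_le] at htr hdev ⊢
  calc |D ω| ≤ r := (abs_lt_of_sq_lt_sq hdev hrpos.le).le
    _ ≤ _ := by rw [hr]; gcongr

end Joint

theorem theorem3 :
    ∃ C : ℝ, 0 < C ∧
      ∀ (d k : ℕ), 1 ≤ d → ∀ (κ : Fin k → FactorKind)
        {Ω : Type*} [MeasurableSpace Ω] (P : Measure Ω) [IsProbabilityMeasure P]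
        (g : Ω → (Fin k → Fin d) → ℝ),
        Measurable g → HasLaw g (gaussianVectorLaw (Fin k → Fin d)) P →
        (∀ x : Ω → Fin k → Fin d → ℝ,
          Measurable x → HasLaw x (factorsLaw d κ) P → IndepFun g x P →
          MemLp (fun ω => quadForm (rankOne (g ω)) (kroneckerVec (x ω))) 2 P ∧
          3 / 4 ≤ P.real {ω |
            Var[fun ω' => quadForm (rankOne (g ω')) (kroneckerVec (x ω')); P |
                MeasurableSpace.comap g inferInstance] ω
              ≤ C * ((2 + 1 / (d : ℝ)) ^ k * (rankOne (g ω)).trace ^ 2)}) ∧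
        (∀ (ε : ℝ), 0 < ε → ∀ (ℓ : ℕ), C * ((2 + 1 / (d : ℝ)) ^ k / ε ^ 2) ≤ (ℓ : ℝ) →
          ∀ x : Fin ℓ → Ω → Fin k → Fin d → ℝ,
          (∀ j, Measurable (x j)) → (∀ j, HasLaw (x j) (factorsLaw d κ) P) →
          iIndepFun x P → IndepFun g (fun ω j => x j ω) P →
          2 / 3 ≤ P.real {ω |
            |kroneckerHutchinson (rankOne (g ω)) (fun j => x j ω) - (rankOne (g ω)).trace|
              ≤ ε * (rankOne (g ω)).trace}) := by
  exact ⟨24 * 512 ^ 2, by norm_num, fun d k hd κ _ _ _ _ _ hgm hg =>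
    ⟨fun _ hxm hx hgx => ⟨memLp_quadForm_rankOne_kroneckerVec hgm hg hxm hx hgx,
      measureReal_condVar_quadForm_le hd hgm hg hxm hx hgx⟩,
    fun _ hε _ hℓ _ hxm hx hxi hgx =>
      measureReal_kroneckerHutchinson_sub_trace_le hd hgm hg hε hℓ hxm hx hxi hgx⟩⟩
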